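/- Let $M$ be a von Neumann algebra on a complex Hilbert space with a normal tracial state $\tau$ (faithfulness is not needed), and let $\mathrm{tr}_N$ be the normalized trace on $M_N(\mathbb{C})$ and $\gamma_{\mathrm{U}(N)}$ the Haar probability measure on the unitary group $\mathrm{U}(N)$. Identify $d\in\mathbb{R}^N_{\ge}=\{d_1\ge\dots\ge d_N\}$ with the corresponding diagonal matrix. For self-adjoint $X_1,\dots,X_n\in M$, for $N,m\in\mathbb{N}$ and $R,\delta>0$, let $\Delta_R(X_i;N,m,\delta)$ be the set of $D\in\mathbb{R}^N_{\ge}$ with $\|D\|_\infty\le R$ and $|\mathrm{tr}_N(D^k)-\tau(X_i^k)|<\delta$ for $1\le k\le m$, and let $\Gamma_{\mathrm{orb},R}(X_1,\dots,X_n;N,m,\delta)$ be the set of $(U_1,\dots,U_n)\in\mathrm{U}(N)^n$ for which there are $D_i\in\Delta_R(X_i;N,m,\delta)$, $1\le i\le n$, with $$\bigl|\mathrm{tr}_N(U_{i_1}D_{i_1}U_{i_1}^*\cdots U_{i_k}D_{i_k}U_{i_k}^*)-\tau(X_{i_1}\cdots X_{i_k})\bigr|<\delta$$ for all $1\le k\le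 m$ and $1\le i_1,\dots,i_k\le n$. The orbital free entropy is $$\chi_{\mathrm{orb}}(X_1,\dots,X_n):=\sup_{R>0}\ \lim_{m\to\infty,\,\delta\searrow0}\ \limsup_{N\to\infty}\frac1{N^2}\log\gamma_{\mathrm{U}(N)}^{\otimes n}\bigl(\Gamma_{\mathrm{orb},R}(X_1,\dots,X_n;N,m,\delta)\bigr)\in[-\infty,0].$$ For $X\in M$ let $W^*(X)$ be the von Neumann subalgebra of $M$ generated by $X$ and the unit of $M$. Then $\chi_{\mathrm{orb}}(X_1,\dots,X_n)$ depends only on $W^*(X_1),\dots,W^*(X_n)$: if $X_1,\dots,X_n,X_1',\dots,X_n'\in M$ are self-adjoint and $W^*(X_i)=W^*(X_i')$ for $1\le i\le n$, then $$\chi_{\mathrm{orb}}(X_1,\dots,X_n)=\chi_{\mathrm{orb}}(X_1',\dots,X_n').$$ -/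

import Mathlib

open Filter Topology MeasureTheory
open scoped ComplexOrder

noncomputable section

namespace OrbitalEntropy

universe u

/-! ### Tracial `W*`-probability spaces -/

section VonNeumann

variable {H : Type u} [NormedAddCommGroup H] [InnerProductSpace ℂ H] [CompleteSpace H]

/-- The von Neumann algebra `W*(x)` on `H` generated by an operator `x` and the unit: the double
commutant of `{x, x*}`. It is the smallest von Neumann algebra on `H` that contains `x`, see
`isLeast_vonNeumannGenerated`. -/
def vonNeumannGenerated (x : H →L[ℂ] H) : VonNeumannAlgebra H where
  toStarSubalgebra :=
    StarSubalgebra.centralizer ℂ (StarSubalgebra.centralizer ℂ {x} : Set (H →L[ℂ] H))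
  centralizer_centralizer' := by simp

theorem isLeast_vonNeumannGenerated (x : H →L[ℂ] H) :
    IsLeast {S : VonNeumannAlgebra H | x ∈ S} (vonNeumannGenerated x) := by
  have hcoe : (vonNeumannGenerated x : Set (H →L[ℂ] H)) =
      Set.centralizer (Set.centralizer ({x} ∪ star {x})) := by
    change ((StarSubalgebra.centralizer ℂ
      (StarSubalgebra.centralizer ℂ {x} : Set (H →L[ℂ] H)) :
        StarSubalgebra ℂ (H →L[ℂ] H)) : Set (H →L[ℂ] H)) = _
    rw [StarSubalgebra.coe_centralizer, StarMemClass.star_coe_eq, Set.union_self,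
      StarSubalgebra.coe_centralizer]
  constructor
  · change x ∈ (vonNeumannGenerated x : Set (H →L[ℂ] H))
    rw [hcoe]
    exact Set.subset_centralizer_centralizer (Or.inl rfl)
  · intro S hS
    change (vonNeumannGenerated x : Set (H →L[ℂ] H)) ⊆ (S : Set (H →L[ℂ] H))
    rw [hcoe, ← S.centralizer_centralizer]
    refine Set.centralizer_subset (Set.centralizer_subset ?_)
    rintro y (hy | hy)
    · rw [Set.mem_singleton_iff] at hy
      exact hy ▸ hS
    · have hy' : star y = x := hy
      have : star (star y) ∈ S := star_mem (hy'.symm ▸ hS)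
      simpa using this

/-- A linear functional on a von Neumann algebra is normal if it is continuous for the ultraweak
(`σ`-weak) topology, i.e. it has the form `a ↦ ∑ₖ ⟪ξₖ, a ηₖ⟫` for two square-summable sequences
of vectors. -/
def IsNormalFunctional {M : VonNeumannAlgebra H} (φ : M.toStarSubalgebra →ₗ[ℂ] ℂ) : Prop :=
  ∃ ξ η : ℕ → H, Summable (fun k => ‖ξ k‖ ^ 2) ∧ Summable (fun k => ‖η k‖ ^ 2) ∧
    ∀ a : M.toStarSubalgebra,
      HasSum (fun k => inner ℂ (ξ k) ((a : H →L[ℂ] H) (η k))) (φ a)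

/-- `τ` is a normal tracial state on the von Neumann algebra `M`. -/
structure IsNormalTracialState {M : VonNeumannAlgebra H} (τ : M.toStarSubalgebra →ₗ[ℂ] ℂ) :
    Prop where
  map_one : τ 1 = 1
  map_star_mul_self_nonneg : ∀ a, 0 ≤ τ (star a * a)
  map_mul_comm : ∀ a b, τ (a * b) = τ (b * a)
  normal : IsNormalFunctional τ

end VonNeumann

/-! ### Haar measure on the unitary groups -/

/-- The compact group of `N × N` complex unitary matrices. -/
abbrev U (N : ℕ) : Type := Matrix.unitaryGroup (Fin N) ℂ

instance instMeasurableSpaceU (N : ℕ) : MeasurableSpace (U N) := borel (U N)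

instance instBorelSpaceU (N : ℕ) : BorelSpace (U N) := ⟨rfl⟩

instance instCompactSpaceU (N : ℕ) : CompactSpace (U N) := by
  refine isCompact_iff_compactSpace.mp
    (?_ : IsCompact (Matrix.unitaryGroup (Fin N) ℂ : Set (Matrix (Fin N) (Fin N) ℂ)))
  have hK : IsCompact (Set.univ.pi fun _ : Fin N => Set.univ.pi fun _ : Fin N =>
      Metric.closedBall (0 : ℂ) 1) :=
    isCompact_univ_pi fun _ => isCompact_univ_pi fun _ => isCompact_closedBall _ _
  refine hK.of_isClosed_subset (isClosed_unitary (R := Matrix (Fin N) (Fin N) ℂ)) ?_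
  intro A hA i _ j _
  simpa using entry_norm_bound_of_unitary hA i j

/-- The Haar probability measure on the unitary group. -/
def haarU (N : ℕ) : Measure (U N) := Measure.haarMeasure ⊤

instance instIsHaarMeasureHaarU (N : ℕ) : (haarU N).IsHaarMeasure :=
  Measure.isHaarMeasure_haarMeasure ⊤

instance instIsProbabilityMeasureHaarU (N : ℕ) : IsProbabilityMeasure (haarU N) :=
  ⟨Measure.haarMeasure_self⟩

/-! ### Orbital microstates and orbital free entropy -/

/-- The normalized trace of an `N × N` matrix. -/
def ntr {N : ℕ} (A : Matrix (Fin N) (Fin N) ℂ) : ℂ := (N : ℂ)⁻¹ * A.trace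

/-- The diagonal matrix with the real diagonal entries `d`. -/
def diag {N : ℕ} (d : Fin N → ℝ) : Matrix (Fin N) (Fin N) ℂ :=
  Matrix.diagonal fun j => (d j : ℂ)

section Orbital

variable {A : Type u} [Ring A] [Algebra ℂ A]

/-- `Δ_R(x; N, m, δ)`: the diagonal matrices with decreasing real diagonal entries, of operator
norm at most `R`, whose moments up to order `m` are `δ`-close to those of `x` with respect
to `τ`. -/
def diagMicrostates (τ : A →ₗ[ℂ] ℂ) (R : ℝ) (x : A) (N m : ℕ) (δ : ℝ) : Set (Fin N → ℝ) :=
  {d | Antitone d ∧ (∀ j, |d j| ≤ R) ∧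
    ∀ k, 1 ≤ k → k ≤ m → ‖ntr (diag d ^ k) - τ (x ^ k)‖ < δ}

/-- `Γ_{orb,R}(x₁, …, xₙ; N, m, δ)`: the orbital microstates, i.e. the tuples `(V₁, …, Vₙ)` of
unitary matrices such that for some `Dᵢ ∈ Δ_R(xᵢ; N, m, δ)` all mixed moments of
`V₁ D₁ V₁*, …, Vₙ Dₙ Vₙ*` up to order `m` are `δ`-close to those of `x₁, …, xₙ`. -/
def orbMicrostates (τ : A →ₗ[ℂ] ℂ) (R : ℝ) {n : ℕ} (x : Fin n → A) (N m : ℕ) (δ : ℝ) :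
    Set (Fin n → U N) :=
  {V | ∃ d : Fin n → Fin N → ℝ, (∀ i, d i ∈ diagMicrostates τ R (x i) N m δ) ∧
    ∀ k, 1 ≤ k → k ≤ m → ∀ w : Fin k → Fin n,
      ‖ntr (List.ofFn fun l => (V (w l) : Matrix (Fin N) (Fin N) ℂ) * diag (d (w l)) *
            star (V (w l) : Matrix (Fin N) (Fin N) ℂ)).prod
          - τ (List.ofFn fun l => x (w l)).prod‖ < δ}

/-- `limsup_{N → ∞} N⁻² log γ_{U(N)}^{⊗ n}(Γ_{orb,R}(x₁, …, xₙ; N, m, δ))`, an extended real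
number, where `log 0 = -∞`. -/
def orbRate (τ : A →ₗ[ℂ] ℂ) (R : ℝ) {n : ℕ} (x : Fin n → A) (m : ℕ) (δ : ℝ) : EReal :=
  limsup (fun N : ℕ => (((N : ℝ) ^ 2)⁻¹ : ℝ) *
    ENNReal.log (Measure.pi (fun _ : Fin n => haarU N) (orbMicrostates τ R x N m δ))) atTop

/-- `χ_{orb,R}(x₁, …, xₙ)`, the limit of `orbRate` as `m → ∞` and `δ ↘ 0`. Since `orbRate`
decreases along this limit, it is an infimum; see `tendsto_orbRate`. -/
def chiOrbCutoff (τ : A →ₗ[ℂ] ℂ) (R : ℝ) {n : ℕ} (x : Fin n → A) : EReal :=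
  ⨅ (m : ℕ) (δ : ℝ) (_ : 0 < δ), orbRate τ R x m δ

/-- The orbital free entropy `χ_orb(x₁, …, xₙ) = sup_{R > 0} χ_{orb,R}(x₁, …, xₙ)`. -/
def chiOrb (τ : A →ₗ[ℂ] ℂ) {n : ℕ} (x : Fin n → A) : EReal :=
  ⨆ (R : ℝ) (_ : 0 < R), chiOrbCutoff τ R x

theorem orbRate_mono (τ : A →ₗ[ℂ] ℂ) (R : ℝ) {n : ℕ} (x : Fin n → A) {m m' : ℕ} {δ δ' : ℝ}
    (hm : m ≤ m') (hδ : δ' ≤ δ) : orbRate τ R x m' δ' ≤ orbRate τ R x m δ := by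
  refine limsup_le_limsup (Eventually.of_forall fun N => ?_)
  refine mul_le_mul_of_nonneg_left (ENNReal.log_monotone (measure_mono ?_)) ?_
  · rintro V ⟨d, hd, hw⟩
    refine ⟨d, fun i => ⟨(hd i).1, (hd i).2.1, fun k h1 h2 => ?_⟩, fun k h1 h2 w => ?_⟩
    · exact ((hd i).2.2 k h1 (h2.trans hm)).trans_le hδ
    · exact (hw k h1 (h2.trans hm) w).trans_le hδ
  · exact EReal.coe_nonneg.mpr (by positivity)

theorem tendsto_orbRate (τ : A →ₗ[ℂ] ℂ) (R : ℝ) {n : ℕ} (x : Fin n → A) :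
    Tendsto (fun p : ℕ × ℝ => orbRate τ R x p.1 p.2) (atTop ×ˢ 𝓝[>] 0)
      (𝓝 (chiOrbCutoff τ R x)) := by
  refine tendsto_order.2 ⟨fun a ha => ?_, fun a ha => ?_⟩
  · have h : ∀ᶠ p : ℕ × ℝ in atTop ×ˢ 𝓝[>] 0, 0 < p.2 :=
      tendsto_snd.eventually self_mem_nhdsWithin
    filter_upwards [h] with p hp
    exact ha.trans_le ((iInf_le _ p.1).trans (iInf₂_le p.2 hp))
  · simp only [chiOrbCutoff, iInf_lt_iff] at ha
    obtain ⟨m, δ, hδ, h⟩ := ha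
    have h1 : ∀ᶠ p : ℕ × ℝ in atTop ×ˢ 𝓝[>] 0, m ≤ p.1 :=
      tendsto_fst.eventually (eventually_ge_atTop m)
    have h2 : ∀ᶠ p : ℕ × ℝ in atTop ×ˢ 𝓝[>] 0, p.2 ≤ δ :=
      tendsto_snd.eventually (nhdsWithin_le_nhds (Iic_mem_nhds hδ))
    filter_upwards [h1, h2] with p hp1 hp2
    exact (orbRate_mono τ R x hp1 hp2).trans_lt h

end Orbital

end OrbitalEntropy

end

/-! By symmetry it suffices to prove `chiOrb τ X ≤ chiOrb τ X'` when every `X' i` lies in `W*(X i)`.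

On the operator side, `X' i` is replaced by a real polynomial `p i` in `X i`. The double commutant
theorem gives polynomials close to `X' i` on finitely many vectors. Truncation in the functional
calculus and Weierstrass approximation make them bounded by some `R' > ‖X' i‖` on a whole interval
`[-R, R]`, as in Kaplansky's theorem. This bound controls the tail of the series defining the normal
functional `τ`, so mixed moments of the `p i (X i)` are close to those of the `X' i`
(`norm_trace_word_sub_le`).

On the matrix side, let `V` be an orbital microstate of `X`, witnessed by diagonal matrices `D i`.
Then `V i * p i (D i) * (V i)*` is `p i` of `V i * D i * (V i)*`, so its mixed moments are close to
those of the `p i (X i)`, and the entries of `p i (D i)` are at most `R'` in absolute value. These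
entries need not be decreasing; sorting them multiplies `V i` on the right by a permutation matrix.

Hence the microstates of `X` are covered by `(N!)^n` right translates of those of `X'`. Haar measure
is right invariant and `log (N!)^n = O(N log N)`, which disappears after division by `N²`. -/

/-- The diagonal action of an operator on a finite Hilbert space power. -/
noncomputable def amplify {H : Type*} [NormedAddCommGroup H] [InnerProductSpace ℂ H] (n : ℕ)
    (T : H →L[ℂ] H) : PiLp 2 (fun _ : Fin n => H) →L[ℂ] PiLp 2 (fun _ : Fin n => H) :=
  (PiLp.continuousLinearEquiv 2 ℂ (fun _ : Fin n => H)).symm.toContinuousLinearMap ∘L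
    (ContinuousLinearMap.pi fun i => T ∘L ContinuousLinearMap.proj i) ∘L
    (PiLp.continuousLinearEquiv 2 ℂ (fun _ : Fin n => H)).toContinuousLinearMap

/-- The inclusion of a summand into a finite Hilbert space power. -/
noncomputable def summandIncl {H : Type*} [NormedAddCommGroup H] [InnerProductSpace ℂ H] (n : ℕ)
    (k : Fin n) : H →L[ℂ] PiLp 2 (fun _ : Fin n => H) :=
  (PiLp.continuousLinearEquiv 2 ℂ (fun _ : Fin n => H)).symm.toContinuousLinearMap ∘L
    (ContinuousLinearMap.single ℂ (fun _ : Fin n => H) k)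

/-- The projection of a finite Hilbert space power onto a summand. -/
noncomputable def summandProj {H : Type*} [NormedAddCommGroup H] [InnerProductSpace ℂ H] (n : ℕ)
    (k : Fin n) : PiLp 2 (fun _ : Fin n => H) →L[ℂ] H :=
  ContinuousLinearMap.proj k ∘L
    (PiLp.continuousLinearEquiv 2 ℂ (fun _ : Fin n => H)).toContinuousLinearMap

section Amplification

variable {H : Type*} [NormedAddCommGroup H] [InnerProductSpace ℂ H] {n : ℕ}

@[simp] theorem amplify_apply (T : H →L[ℂ] H) (v : PiLp 2 (fun _ : Fin n => H)) (i : Fin n) :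
    amplify n T v i = T (v i) := rfl

theorem summandIncl_apply (k : Fin n) (h : H) (i : Fin n) :
    summandIncl n k h i = (Pi.single k h : Fin n → H) i := rfl

theorem sum_summandIncl (v : PiLp 2 (fun _ : Fin n => H)) :
    ∑ k, summandIncl n k (v k) = v := by
  ext i
  simp [summandIncl_apply, Finset.sum_apply, Pi.single_apply]

theorem amplify_summandIncl (T : H →L[ℂ] H) (k : Fin n) (h : H) :
    amplify n T (summandIncl n k h) = summandIncl n k (T h) := by
  ext i
  rw [amplify_apply, summandIncl_apply, summandIncl_apply]
  by_cases hi : i = k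
  · subst hi; simp
  · simp [Pi.single_eq_of_ne hi]

theorem amplify_mul (S T : H →L[ℂ] H) (v : PiLp 2 (fun _ : Fin n => H)) :
    amplify n (S * T) v = amplify n S (amplify n T v) := rfl

/-- An operator on `Hⁿ` commutes with `b ⊕ ⋯ ⊕ b` if all its matrix entries commute with `b`. -/
theorem amplify_comm_of_entries (b : H →L[ℂ] H)
    (p : PiLp 2 (fun _ : Fin n => H) →L[ℂ] PiLp 2 (fun _ : Fin n => H))
    (hp : ∀ j k, Commute (summandProj n j ∘L p ∘L summandIncl n k) b)
    (v : PiLp 2 (fun _ : Fin n => H)) : p (amplify n b v) = amplify n b (p v) := by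
  have h : ∀ k h, p (amplify n b (summandIncl n k h)) = amplify n b (p (summandIncl n k h)) := by
    intro k h
    ext j
    have := congrArg (fun T : H →L[ℂ] H => T h) (hp j k).eq
    rw [amplify_summandIncl, amplify_apply]
    exact this
  rw [← sum_summandIncl v]
  simp only [map_sum, h]

theorem inner_amplify_of_isSelfAdjoint [CompleteSpace H] {x : H →L[ℂ] H} (hx : IsSelfAdjoint x)
    (v w : PiLp 2 (fun _ : Fin n => H)) :
    inner ℂ (amplify n x v) w = inner ℂ v (amplify n x w) := by
  rw [PiLp.inner_apply, PiLp.inner_apply]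
  exact Finset.sum_congr rfl fun i _ => hx.isSymmetric (v i) (w i)

end Amplification

/-! ### Polynomial approximation in the double commutant -/

section DoubleCommutant

variable {H : Type*} [NormedAddCommGroup H] [InnerProductSpace ℂ H] [CompleteSpace H]

open Polynomial in
/-- The double commutant theorem for one self-adjoint operator: an operator in the double commutant
of `x` is approximated on finitely many vectors by polynomials in `x`. -/
theorem exists_polynomial_near_of_doubleCommutant {x b : H →L[ℂ] H} (hx : IsSelfAdjoint x)
    (hb : ∀ T : H →L[ℂ] H, Commute T x → Commute T b) {n : ℕ} (η : Fin n → H) {ε : ℝ}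
    (hε : 0 < ε) : ∃ q : ℂ[X], ∀ k, ‖(aeval x q - b) (η k)‖ < ε := by
  let v : PiLp 2 (fun _ : Fin n => H) := WithLp.toLp 2 η
  let L : ℂ[X] →ₗ[ℂ] PiLp 2 (fun _ : Fin n => H) :=
    { toFun := fun q => amplify n (aeval x q) v
      map_add' := fun p q => by ext i; simp
      map_smul' := fun c q => by ext i; simp }
  -- The closed cyclic subspace generated by `v` under the amplification of `x`.
  let S : Submodule ℂ (PiLp 2 (fun _ : Fin n => H)) := (LinearMap.range L).topologicalClosure
  have hSc : IsClosed (S : Set (PiLp 2 (fun _ : Fin n => H))) :=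
    Submodule.isClosed_topologicalClosure _
  have : CompleteSpace S := hSc.completeSpace_coe
  have hSx : ∀ s ∈ S, amplify n x s ∈ S := by
    intro s hs
    refine map_mem_closure (amplify n x).continuous hs ?_
    rintro _ ⟨q, rfl⟩
    refine ⟨X * q, ?_⟩
    change amplify n (aeval x (X * q)) v = amplify n x (amplify n (aeval x q) v)
    rw [map_mul, aeval_X, amplify_mul]
  -- An invariant subspace of a self-adjoint operator is reducing, so its projection commutes with
  -- the operator.
  have hp : ∀ w, S.starProjection (amplify n x w) = amplify n x (S.starProjection w) := by
    intro w
    refine Submodule.eq_starProjection_of_mem_orthogonal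
      (hSx _ (Submodule.starProjection_apply_mem S w)) ?_
    rw [← map_sub, Submodule.mem_orthogonal]
    intro u hu
    rw [← inner_amplify_of_isSelfAdjoint hx]
    exact (Submodule.mem_orthogonal _ _).1 (Submodule.sub_starProjection_mem_orthogonal w) _
      (hSx u hu)
  -- The matrix entries of the projection commute with `x`, hence with `b`; so `S` is invariant
  -- under the amplification of `b` as well.
  have hpb := amplify_comm_of_entries b S.starProjection (fun j k => hb _ (by
    ext h
    change summandProj n j (S.starProjection (summandIncl n k (x h))) =
      x (summandProj n j (S.starProjection (summandIncl n k h)))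
    rw [← amplify_summandIncl, hp]
    rfl)) v
  have hv : v ∈ S := by
    refine Submodule.le_topologicalClosure _ ⟨1, ?_⟩
    ext i
    simp [L]
  rw [Submodule.starProjection_eq_self_iff.2 hv] at hpb
  have hbv : amplify n b v ∈ closure (LinearMap.range L : Set (PiLp 2 (fun _ : Fin n => H))) := by
    have := Submodule.starProjection_apply_mem S (amplify n b v)
    rw [hpb] at this
    exact this
  obtain ⟨_, ⟨q, rfl⟩, hq⟩ := Metric.mem_closure_iff.1 hbv ε hε
  refine ⟨q, fun k => ?_⟩
  refine lt_of_le_of_lt ?_ hq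
  rw [dist_comm, dist_eq_norm]
  exact PiLp.norm_apply_le (L q - amplify n b v) k

end DoubleCommutant

/-! ### Bounded approximation in the manner of Kaplansky -/

section Truncation

variable {H : Type*} [NormedAddCommGroup H] [InnerProductSpace ℂ H] [CompleteSpace H]

theorem norm_apply_le_of_mul_self_le {a b : H →L[ℂ] H} (ha : IsSelfAdjoint a)
    (hb : IsSelfAdjoint b) (h : a * a ≤ b * b) (v : H) : ‖a v‖ ≤ ‖b v‖ := by
  have h1 := ((ContinuousLinearMap.le_def _ _).1 h).re_inner_nonneg_right v
  have e : ∀ c : H →L[ℂ] H, IsSelfAdjoint c → RCLike.re (inner ℂ v ((c * c) v)) = ‖c v‖ ^ 2 := by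
    intro c hc
    have : inner ℂ v ((c * c) v) = inner ℂ (c v) (c v) := (hc.isSymmetric v (c v)).symm
    rw [this, inner_self_eq_norm_sq]
  rw [sub_apply, inner_sub_right, map_sub, e b hb, e a ha] at h1
  exact le_of_sq_le_sq (by linarith) (norm_nonneg _)

/-- Truncating a self-adjoint operator at level `r` brings it closer, on every vector, to each
operator of norm at most `r` that commutes with it. -/
theorem norm_cfc_truncate_sub_apply_le {x b : H →L[ℂ] H}
    (hb : IsSelfAdjoint b) (hxb : Commute x b) {r : ℝ} (hr : ‖b‖ ≤ r) {g : ℝ → ℝ}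
    (hg : Continuous g) (v : H) :
    ‖(cfc (fun t => max (-r) (min r (g t))) x - b) v‖ ≤ ‖(cfc g x - b) v‖ := by
  have hr0 : 0 ≤ r := (norm_nonneg _).trans hr
  set c := cfc (fun t => max (-r) (min r (g t))) x with hc
  set s := cfc g x with hs
  -- `e` and `f` are the excesses of `g` above `r` and below `-r`. Where `e` lives `c` equals `r`,
  -- and where `f` lives `c` equals `-r`.
  set e := cfc (fun t => max (g t - r) 0) x with he
  set f := cfc (fun t => max (-r - g t) 0) x with hf
  have cf : Continuous fun t => max (-r) (min r (g t)) := by fun_prop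
  have ce : Continuous fun t => max (g t - r) 0 := by fun_prop
  have cff : Continuous fun t => max (-r - g t) 0 := by fun_prop
  have he0 : 0 ≤ e := cfc_nonneg fun t _ => le_max_right _ _
  have hf0 : 0 ≤ f := cfc_nonneg fun t _ => le_max_right _ _
  have hsum : s = c + e - f := by
    rw [hs, hc, he, hf, ← cfc_add _ _ _ (by fun_prop) (by fun_prop),
      ← cfc_sub _ _ _ (by fun_prop) (by fun_prop)]
    congr 1; funext t
    rcases le_total (g t) r with h1 | h1 <;> rcases le_total (-r) (g t) with h2 | h2
    · rw [min_eq_right h1, max_eq_right h2, max_eq_right (by linarith), max_eq_right (by linarith)]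
      ring
    · rw [min_eq_right h1, max_eq_left h2, max_eq_right (by linarith), max_eq_left (by linarith)]
      ring
    · rw [min_eq_left h1, max_eq_right (by linarith), max_eq_left (by linarith),
        max_eq_right (by linarith)]
      ring
    · have : g t = r := by linarith
      have h0 : r = 0 := by linarith
      simp [this, h0]
  have hec : e * c = r • e := by
    rw [he, hc, ← cfc_mul _ _ _ (by fun_prop) (by fun_prop), ← cfc_const_mul r _ _ (by fun_prop)]
    congr 1; funext t
    rcases le_total (g t) r with h1 | h1
    · rw [max_eq_right (by linarith : g t - r ≤ 0)]; ring
    · rw [min_eq_left h1, max_eq_right (by linarith : -r ≤ r)]; ring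
  have hfc : f * c = -(r • f) := by
    rw [hf, hc, ← cfc_mul _ _ _ (by fun_prop) (by fun_prop), ← cfc_const_mul r _ _ (by fun_prop),
      ← cfc_neg]
    congr 1; funext t
    rcases le_total (-r) (g t) with h1 | h1
    · rw [max_eq_right (by linarith : -r - g t ≤ 0)]; ring
    · rw [min_eq_right (by linarith), max_eq_left h1]; ring
  have hcs : IsSelfAdjoint c := cfc_predicate _ _
  have hss : IsSelfAdjoint s := cfc_predicate _ _
  have heb : Commute e b := hxb.cfc_real _
  have hfb : Commute f b := hxb.cfc_real _
  have hcb : Commute c b := hxb.cfc_real _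
  have hce : Commute c e := cfc_commute_cfc _ _ _
  have hcf : Commute c f := cfc_commute_cfc _ _ _
  have hbr : 0 ≤ r • (1 : H →L[ℂ] H) - b := by
    rw [sub_nonneg, ← Algebra.algebraMap_eq_smul_one]
    exact hb.le_algebraMap_norm_self.trans (algebraMap_mono _ hr)
  have hbr' : 0 ≤ r • (1 : H →L[ℂ] H) + b := by
    have h1 := hb.neg_algebraMap_norm_le_self
    have h2 : algebraMap ℝ (H →L[ℂ] H) ‖b‖ ≤ algebraMap ℝ (H →L[ℂ] H) r := algebraMap_mono _ hr
    rw [← Algebra.algebraMap_eq_smul_one, ← sub_neg_eq_add, sub_nonneg]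
    exact (neg_le.1 h1).trans h2
  have p1 : 0 ≤ e * (r • (1 : H →L[ℂ] H) - b) :=
    Commute.mul_nonneg he0 hbr (((Commute.one_right e).smul_right r).sub_right heb)
  have p2 : 0 ≤ f * (r • (1 : H →L[ℂ] H) + b) :=
    Commute.mul_nonneg hf0 hbr' (((Commute.one_right f).smul_right r).add_right hfb)
  have hefs : IsSelfAdjoint (e - f) := (cfc_predicate _ _ : IsSelfAdjoint e).sub (cfc_predicate _ _)
  have p3 : 0 ≤ (e - f) * (e - f) := hefs.mul_self_nonneg
  refine norm_apply_le_of_mul_self_le (hcs.sub hb) (hss.sub hb) ?_ v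
  rw [← sub_nonneg]
  -- Expand the square of `s - b = (c - b) + (e - f)` using `c * e = r • e` and `c * f = -(r • f)`.
  -- Each summand is nonnegative because `-r ≤ b ≤ r` and everything commutes.
  have key : (s - b) * (s - b) - (c - b) * (c - b) = (e - f) * (e - f) +
      2 • (e * (r • (1 : H →L[ℂ] H) - b) + f * (r • (1 : H →L[ℂ] H) + b)) := by
    have h1 := hce.eq
    have h2 := hcf.eq
    have h3 := heb.eq
    have h4 := hfb.eq
    rw [hsum]
    simp only [mul_add, mul_sub, add_mul, sub_mul, mul_smul_comm, mul_one, h1, h2, ← h3, ← h4, hec,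
      hfc]
    abel
  rw [key]
  exact add_nonneg p3 (nsmul_nonneg (add_nonneg p1 p2) 2)

open Polynomial in
theorem Polynomial.exists_real_add_I_mul (q : ℂ[X]) : ∃ q₁ q₂ : ℝ[X],
    q = q₁.map (algebraMap ℝ ℂ) + C Complex.I * q₂.map (algebraMap ℝ ℂ) := by
  induction q using Polynomial.induction_on' with
  | add p q hp hq =>
    obtain ⟨p₁, p₂, hp⟩ := hp
    obtain ⟨q₁, q₂, hq⟩ := hq
    exact ⟨p₁ + q₁, p₂ + q₂, by rw [hp, hq, Polynomial.map_add, Polynomial.map_add]; ring⟩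
  | monomial n a =>
    refine ⟨monomial n a.re, monomial n a.im, ?_⟩
    rw [map_monomial, map_monomial, C_mul_monomial, ← map_add]
    congr 1
    simp [mul_comm Complex.I, Complex.re_add_im]

open Polynomial in
theorem isSelfAdjoint_aeval_real {x : H →L[ℂ] H} (hx : IsSelfAdjoint x) (p : ℝ[X]) :
    IsSelfAdjoint (aeval x p) := by
  rw [← cfc_polynomial p x]
  exact cfc_predicate _ _

open Polynomial in
/-- Passing to the real part of a polynomial in `x` does not increase the distance, on every
vector, to a self-adjoint operator commuting with `x`. -/
theorem norm_aeval_re_sub_apply_le {x b : H →L[ℂ] H} (hx : IsSelfAdjoint x)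
    (hb : IsSelfAdjoint b) (hxb : Commute x b) (q₁ q₂ : ℝ[X]) (v : H) :
    ‖(aeval x q₁ - b) v‖ ≤
      ‖(aeval x (q₁.map (algebraMap ℝ ℂ) + C Complex.I * q₂.map (algebraMap ℝ ℂ)) - b) v‖ := by
  have hA : aeval x (q₁.map (algebraMap ℝ ℂ) + C Complex.I * q₂.map (algebraMap ℝ ℂ)) =
      aeval x q₁ + Complex.I • aeval x q₂ := by
    rw [map_add, map_mul, aeval_C, aeval_map_algebraMap, aeval_map_algebraMap, Algebra.smul_def]
  rw [hA]
  set s := aeval x q₁ with hs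
  set t := aeval x q₂ with ht
  have h1 : IsSelfAdjoint s := isSelfAdjoint_aeval_real hx _
  have h2 : IsSelfAdjoint t := isSelfAdjoint_aeval_real hx _
  have hst : Commute s t := by
    rw [hs, ht, ← cfc_polynomial q₁ x, ← cfc_polynomial q₂ x]
    exact cfc_commute_cfc _ _ _
  have htb : Commute t b := by
    rw [ht, ← cfc_polynomial q₂ x]
    exact hxb.cfc_real _
  set z := s + Complex.I • t - b with hz
  have hzs : star z = s - Complex.I • t - b := by
    rw [hz, star_sub, star_add, star_smul, h1.star_eq, h2.star_eq, hb.star_eq]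
    simp [sub_eq_add_neg]
  have hnorm : IsStarNormal z := by
    refine ⟨?_⟩
    rw [hzs, hz]
    have : Commute (s - b) (Complex.I • t) := (hst.sub_left htb.symm).smul_right _
    have e1 : s - Complex.I • t - b = (s - b) - Complex.I • t := by abel
    have e2 : s + Complex.I • t - b = (s - b) + Complex.I • t := by abel
    rw [e1, e2]
    exact ((Commute.refl _).add_right this).sub_left (this.symm.add_right (Commute.refl _))
  -- `s - b` is the real part of the normal operator `z`, and normality gives `‖z v‖ = ‖star z v‖`.
  have hsz : (2 : ℂ) • (s - b) = z + star z := by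
    rw [hzs, hz, two_smul]; abel
  have hv : ‖z v‖ = ‖star z v‖ := by
    rw [ContinuousLinearMap.star_eq_adjoint]
    exact ((ContinuousLinearMap.isStarNormal_iff_norm_eq_adjoint).1 hnorm v)
  have h3 : ‖(2 : ℂ) • ((s - b) v)‖ ≤ ‖z v‖ + ‖star z v‖ := by
    rw [← smul_apply, hsz]
    exact norm_add_le _ _
  rw [norm_smul, ← hv] at h3
  rw [Complex.norm_ofNat] at h3
  linarith

open Polynomial in
/-- A form of Kaplansky's density theorem: an operator `b` in the double commutant of a self-adjoint
operator `x` is approximated on finitely many vectors by real polynomials in `x` that are bounded,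
on a prescribed interval containing the spectrum, by any bound larger than `‖b‖`. -/
theorem exists_bounded_polynomial_near_of_doubleCommutant {x b : H →L[ℂ] H}
    (hx : IsSelfAdjoint x) (hbs : IsSelfAdjoint b)
    (hb : ∀ T : H →L[ℂ] H, Commute T x → Commute T b) {R R' : ℝ} (hR : ‖x‖ ≤ R) (hR' : ‖b‖ < R')
    {n : ℕ} (η : Fin n → H) {ε : ℝ} (hε : 0 < ε) :
    ∃ p : ℝ[X], (∀ t, |t| ≤ R → |p.eval t| ≤ R') ∧ ‖aeval x p‖ ≤ R' ∧
      ∀ k, ‖(aeval x p - b) (η k)‖ < ε := by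
  obtain ⟨q, hq⟩ := exists_polynomial_near_of_doubleCommutant hx hb η (half_pos hε)
  obtain ⟨q₁, q₂, rfl⟩ := q.exists_real_add_I_mul
  have hxb : Commute x b := hb x (Commute.refl x)
  set C : ℝ := 1 + ∑ k, ‖η k‖ with hC
  have hC0 : 0 < C := by
    have : 0 ≤ ∑ k, ‖η k‖ := Finset.sum_nonneg fun _ _ => norm_nonneg _
    linarith
  have hR0 : 0 ≤ R' := (norm_nonneg b).trans hR'.le
  -- Truncating at `‖b‖` rather than `R'` leaves the gap `R' - ‖b‖` for the Weierstrass error.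
  let F : ℝ → ℝ := fun t => max (-‖b‖) (min ‖b‖ (q₁.eval t))
  have hF : Continuous F := by fun_prop
  have hδ : 0 < min (R' - ‖b‖) (ε / 2 / C) := lt_min (sub_pos.2 hR') (by positivity)
  obtain ⟨p, hp⟩ := exists_polynomial_near_of_continuousOn (-R) R F hF.continuousOn _ hδ
  have hspec : ∀ t ∈ spectrum ℝ x, t ∈ Set.Icc (-R) R := fun t ht =>
    abs_le.1 (by
      have := norm_apply_le_norm_cfc (id : ℝ → ℝ) x ht
      rw [cfc_id ℝ x] at this
      exact this.trans hR)
  have hbd : ∀ t, |t| ≤ R → |p.eval t| ≤ R' := by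
    intro t ht
    have h1 := (hp t (abs_le.1 ht)).trans_le (min_le_left _ _)
    have h2 : |F t| ≤ ‖b‖ :=
      abs_le.2 ⟨le_max_left _ _, max_le (by linarith [norm_nonneg b]) (min_le_left _ _)⟩
    have h3 := abs_sub_abs_le_abs_sub (p.eval t) (F t)
    linarith
  refine ⟨p, hbd, ?_, fun k => ?_⟩
  · rw [← cfc_polynomial p x]
    exact norm_cfc_le hR0 fun t ht => hbd t (abs_le.2 (hspec t ht))
  · have h1 : ‖aeval x p - cfc F x‖ ≤ ε / 2 / C := by
      rw [← cfc_polynomial p x, ← cfc_sub _ _ _ (by fun_prop) (by fun_prop)]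
      exact norm_cfc_le (by positivity) fun t ht =>
        ((hp t (hspec t ht)).le.trans (min_le_right _ _))
    have h2 : ‖(cfc F x - b) (η k)‖ < ε / 2 := by
      refine lt_of_le_of_lt ?_ (hq k)
      refine (norm_cfc_truncate_sub_apply_le hbs hxb le_rfl q₁.continuous (η k)).trans ?_
      rw [cfc_polynomial q₁ x]
      exact norm_aeval_re_sub_apply_le hx hbs hxb q₁ q₂ _
    have h3 : ‖(aeval x p - cfc F x) (η k)‖ ≤ ε / 2 := by
      refine ((aeval x p - cfc F x).le_opNorm _).trans ?_
      have h4 : ‖η k‖ ≤ C := by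
        have := Finset.single_le_sum (f := fun k => ‖η k‖) (fun _ _ => norm_nonneg _)
          (Finset.mem_univ k)
        linarith
      calc _ ≤ ε / 2 / C * C := mul_le_mul h1 h4 (norm_nonneg _) (by positivity)
        _ = ε / 2 := by field_simp
    calc ‖(aeval x p - b) (η k)‖ = ‖(aeval x p - cfc F x) (η k) + (cfc F x - b) (η k)‖ := by
          rw [← add_apply]; congr 2; abel
      _ ≤ _ := norm_add_le _ _
      _ < ε := by linarith

end Truncation

/-! ### Approximation under a normal functional -/

namespace OrbitalEntropy

section Normal

variable {H : Type*} [NormedAddCommGroup H] [InnerProductSpace ℂ H] [CompleteSpace H]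

theorem commute_of_mem_vonNeumannGenerated {x b T : H →L[ℂ] H} (hx : IsSelfAdjoint x)
    (hb : b ∈ vonNeumannGenerated x) (hT : Commute T x) : Commute T b := by
  have hb' : b ∈ StarSubalgebra.centralizer ℂ
      (StarSubalgebra.centralizer ℂ {x} : Set (H →L[ℂ] H)) := hb
  rw [StarSubalgebra.mem_centralizer_iff] at hb'
  refine (hb' T ?_).1
  change T ∈ StarSubalgebra.centralizer ℂ {x}
  rw [StarSubalgebra.mem_centralizer_iff]
  rintro _ rfl
  rw [hx.star_eq]
  exact ⟨hT.eq.symm, hT.eq.symm⟩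

open Polynomial in
/-- With respect to a normal functional, an element of `W*(x)` is approximated by polynomials in `x`
under a common bound. -/
theorem IsNormalFunctional.exists_polynomial_near {M : VonNeumannAlgebra H}
    {τ : M.toStarSubalgebra →ₗ[ℂ] ℂ} (hτ : IsNormalFunctional τ) {x b : M.toStarSubalgebra}
    (hx : IsSelfAdjoint x) (hb : IsSelfAdjoint b)
    (hbx : (b : H →L[ℂ] H) ∈ vonNeumannGenerated (x : H →L[ℂ] H)) {R R' : ℝ} (hR : ‖x‖ ≤ R)
    (hR' : ‖b‖ < R') {ε : ℝ} (hε : 0 < ε) :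
    ∃ p : ℝ[X], (∀ t, |t| ≤ R → |p.eval t| ≤ R') ∧ ‖aeval x (p.map (algebraMap ℝ ℂ))‖ ≤ R' ∧
      ∀ y : M.toStarSubalgebra,
        ‖τ (y * (aeval x (p.map (algebraMap ℝ ℂ)) - b))‖ ≤ ‖y‖ * ε := by
  obtain ⟨ξ, η, hξ, hη, hsum⟩ := hτ
  have hR0 : 0 < R' := (norm_nonneg b).trans_lt hR'
  have hκ : Summable fun k => ‖ξ k‖ * ‖η k‖ := by
    refine Summable.of_nonneg_of_le (fun k => by positivity) (fun k => ?_) (hξ.add hη)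
    nlinarith [sq_nonneg (‖ξ k‖ - ‖η k‖), sq_nonneg (‖ξ k‖), sq_nonneg (‖η k‖)]
  -- Beyond `n` only the bound `2 * R'` on the norm of the error operator is used; the first `n`
  -- vectors are left to the polynomial approximation.
  obtain ⟨n, hn⟩ := ((tendsto_sum_nat_add fun k => ‖ξ k‖ * ‖η k‖).eventually
    (gt_mem_nhds (show 0 < ε / 2 / (2 * R') by positivity))).exists
  set K : ℝ := 1 + ∑ k ∈ Finset.range n, ‖ξ k‖ with hK
  have hK0 : 0 < K := by
    have : 0 ≤ ∑ k ∈ Finset.range n, ‖ξ k‖ := Finset.sum_nonneg fun _ _ => norm_nonneg _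
    linarith
  have hx' : IsSelfAdjoint (x : H →L[ℂ] H) := congrArg Subtype.val hx
  have hb' : IsSelfAdjoint (b : H →L[ℂ] H) := congrArg Subtype.val hb
  obtain ⟨p, hp, hpx, hpη⟩ := exists_bounded_polynomial_near_of_doubleCommutant hx' hb'
    (fun T hT => commute_of_mem_vonNeumannGenerated hx' hbx hT) hR hR'
    (fun k : Fin n => η k) (show 0 < ε / 2 / K by positivity)
  have hcoe : ((aeval x (p.map (algebraMap ℝ ℂ)) : M.toStarSubalgebra) : H →L[ℂ] H) =
      aeval (x : H →L[ℂ] H) p := by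
    rw [← aeval_map_algebraMap ℂ (x : H →L[ℂ] H) p]
    exact (aeval_algHom_apply M.toStarSubalgebra.subtype.toAlgHom x _).symm
  refine ⟨p, hp, ?_, fun y => ?_⟩
  · change ‖((aeval x (p.map (algebraMap ℝ ℂ)) : M.toStarSubalgebra) : H →L[ℂ] H)‖ ≤ R'
    rwa [hcoe]
  set z : H →L[ℂ] H := aeval (x : H →L[ℂ] H) p - b with hz
  have hznorm : ‖z‖ ≤ 2 * R' := by
    have : ‖(b : H →L[ℂ] H)‖ < R' := hR'
    have := norm_sub_le (aeval (x : H →L[ℂ] H) p) (b : H →L[ℂ] H)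
    linarith
  have hy : ‖(y : H →L[ℂ] H)‖ = ‖y‖ := rfl
  have hs := hsum (y * (aeval x (p.map (algebraMap ℝ ℂ)) - b))
  have hterm : ∀ k, ‖inner ℂ (ξ k) (((y * (aeval x (p.map (algebraMap ℝ ℂ)) - b) :
      M.toStarSubalgebra) : H →L[ℂ] H) (η k))‖ ≤ ‖y‖ * (‖ξ k‖ * ‖z (η k)‖) := by
    intro k
    have : ((y * (aeval x (p.map (algebraMap ℝ ℂ)) - b) : M.toStarSubalgebra) : H →L[ℂ] H) (η k)
        = (y : H →L[ℂ] H) (z (η k)) := by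
      rw [hz, ← hcoe]; rfl
    rw [this]
    calc _ ≤ ‖ξ k‖ * ‖(y : H →L[ℂ] H) (z (η k))‖ := norm_inner_le_norm _ _
      _ ≤ ‖ξ k‖ * (‖(y : H →L[ℂ] H)‖ * ‖z (η k)‖) :=
        mul_le_mul_of_nonneg_left ((y : H →L[ℂ] H).le_opNorm _) (norm_nonneg _)
      _ = _ := by rw [hy]; ring
  have hle : ∀ k, ‖ξ k‖ * ‖z (η k)‖ ≤ 2 * R' * (‖ξ k‖ * ‖η k‖) := by
    intro k
    calc _ ≤ ‖ξ k‖ * (2 * R' * ‖η k‖) :=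
          mul_le_mul_of_nonneg_left (z.le_of_opNorm_le hznorm _) (norm_nonneg _)
      _ = _ := by ring
  have hsm : Summable fun k => ‖ξ k‖ * ‖z (η k)‖ :=
    Summable.of_nonneg_of_le (fun k => by positivity) hle (hκ.mul_left _)
  have hbound : ∑' k, ‖ξ k‖ * ‖z (η k)‖ ≤ ε := by
    rw [← hsm.sum_add_tsum_nat_add n]
    have h1 : ∑ k ∈ Finset.range n, ‖ξ k‖ * ‖z (η k)‖ ≤ ε / 2 := by
      calc _ ≤ ∑ k ∈ Finset.range n, ‖ξ k‖ * (ε / 2 / K) :=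
            Finset.sum_le_sum fun k hk => mul_le_mul_of_nonneg_left
              (hpη ⟨k, Finset.mem_range.1 hk⟩).le (norm_nonneg _)
        _ = (∑ k ∈ Finset.range n, ‖ξ k‖) * (ε / 2 / K) := by rw [Finset.sum_mul]
        _ ≤ K * (ε / 2 / K) := mul_le_mul_of_nonneg_right (by linarith) (by positivity)
        _ = ε / 2 := by field_simp
    have h2 : ∑' k, ‖ξ (k + n)‖ * ‖z (η (k + n))‖ ≤ ε / 2 := by
      calc _ ≤ ∑' k, 2 * R' * (‖ξ (k + n)‖ * ‖η (k + n)‖) :=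
            Summable.tsum_le_tsum (fun k => hle (k + n)) ((summable_nat_add_iff n).2 hsm)
              ((summable_nat_add_iff n (f := fun k => 2 * R' * (‖ξ k‖ * ‖η k‖))).2
                (hκ.mul_left _))
        _ = 2 * R' * ∑' k, ‖ξ (k + n)‖ * ‖η (k + n)‖ := tsum_mul_left
        _ ≤ 2 * R' * (ε / 2 / (2 * R')) := mul_le_mul_of_nonneg_left hn.le (by positivity)
        _ = ε / 2 := by field_simp
    linarith
  calc ‖τ (y * (aeval x (p.map (algebraMap ℝ ℂ)) - b))‖ ≤ ∑' k, ‖y‖ * (‖ξ k‖ * ‖z (η k)‖) :=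
        hs.norm_le_of_bounded (hsm.mul_left _).hasSum hterm
    _ = ‖y‖ * ∑' k, ‖ξ k‖ * ‖z (η k)‖ := tsum_mul_left
    _ ≤ ‖y‖ * ε := mul_le_mul_of_nonneg_left hbound (norm_nonneg _)

end Normal

/-! ### Perturbation of words under a trace -/

section Words

theorem norm_mul_prod_map_le {A ι : Type*} [NormedRing A] {C : ℝ} (hC : 0 ≤ C) {b : ι → A}
    (hb : ∀ i, ‖b i‖ ≤ C) (l : List ι) (y : A) :
    ‖(l.map b).prod * y‖ ≤ C ^ l.length * ‖y‖ := by
  induction l with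
  | nil => simp
  | cons i l ih =>
    rw [List.map_cons, List.prod_cons, mul_assoc, List.length_cons, pow_succ']
    calc _ ≤ ‖b i‖ * ‖(l.map b).prod * y‖ := norm_mul_le _ _
      _ ≤ C * (C ^ l.length * ‖y‖) := mul_le_mul (hb i) ih (norm_nonneg _) hC
      _ = _ := by ring

/-- Replacing the letters of a word by nearby ones under a trace. -/
theorem norm_trace_word_sub_le {A ι : Type*} [NormedRing A] [Algebra ℂ A] {τ : A →ₗ[ℂ] ℂ}
    (hτ : ∀ a b, τ (a * b) = τ (b * a)) {C ε : ℝ} (hC : 1 ≤ C) {p b : ι → A}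
    (hp : ∀ i, ‖p i‖ ≤ C) (hb : ∀ i, ‖b i‖ ≤ C) (h : ∀ i y, ‖τ (y * (p i - b i))‖ ≤ ‖y‖ * ε)
    (l : List ι) (y : A) :
    ‖τ (y * (l.map p).prod) - τ (y * (l.map b).prod)‖ ≤ l.length * C ^ l.length * (‖y‖ * |ε|) := by
  induction l generalizing y with
  | nil => simp
  | cons i l ih =>
    -- Telescoping: after the tail has been treated with `y * p i` in front, traciality rotates the
    -- remaining word so that `p i - b i` comes last, where `h` applies.
    have e : τ (y * (p i * (l.map p).prod)) - τ (y * (b i * (l.map b).prod)) =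
        (τ ((y * p i) * (l.map p).prod) - τ ((y * p i) * (l.map b).prod)) +
          τ (((l.map b).prod * y) * (p i - b i)) := by
      rw [mul_assoc (l.map b).prod, hτ (l.map b).prod, ← mul_assoc, ← mul_assoc, mul_sub, sub_mul,
        map_sub]
      ring
    rw [List.map_cons, List.prod_cons, List.map_cons, List.prod_cons, e, List.length_cons]
    have hC0 : 0 ≤ C := zero_le_one.trans hC
    have h1 : ‖y * p i‖ ≤ ‖y‖ * C :=
      (norm_mul_le _ _).trans (mul_le_mul_of_nonneg_left (hp i) (norm_nonneg _))
    have h2 := norm_mul_prod_map_le hC0 hb l y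
    calc _ ≤ l.length * C ^ l.length * (‖y * p i‖ * |ε|) + ‖(l.map b).prod * y‖ * ε :=
          (norm_add_le _ _).trans (add_le_add (ih _) (h _ _))
      _ ≤ l.length * C ^ l.length * (‖y‖ * C * |ε|) + C ^ l.length * ‖y‖ * |ε| := by
          have : ‖(l.map b).prod * y‖ * ε ≤ ‖(l.map b).prod * y‖ * |ε| :=
            mul_le_mul_of_nonneg_left (le_abs_self ε) (norm_nonneg _)
          refine add_le_add ?_ (this.trans ?_) <;> gcongr
      _ ≤ l.length * C ^ l.length * (‖y‖ * C * |ε|) + C ^ (l.length + 1) * ‖y‖ * |ε| := by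
          gcongr
          omega
      _ = _ := by push_cast; ring

end Words

end OrbitalEntropy

namespace OrbitalEntropy

/-! ### Moments of noncommutative polynomials -/

section Moments

theorem ntr_add {N : ℕ} (A B : Matrix (Fin N) (Fin N) ℂ) : ntr (A + B) = ntr A + ntr B := by
  simp [ntr, Matrix.trace_add, mul_add]

theorem ntr_smul {N : ℕ} (c : ℂ) (A : Matrix (Fin N) (Fin N) ℂ) : ntr (c • A) = c * ntr A := by
  simp [ntr, Matrix.trace_smul, mul_left_comm]

theorem ntr_one {N : ℕ} (hN : N ≠ 0) : ntr (1 : Matrix (Fin N) (Fin N) ℂ) = 1 := by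
  simp [ntr, hN]

theorem ntr_mul_comm {N : ℕ} (A B : Matrix (Fin N) (Fin N) ℂ) : ntr (A * B) = ntr (B * A) := by
  rw [ntr, ntr, Matrix.trace_mul_comm]

/-- All mixed moments up to order `m` of the matrices `y` are `δ`-close to those of `x`. -/
def MomentsNear {A : Type*} [Ring A] [Algebra ℂ A] (τ : A →ₗ[ℂ] ℂ) {n : ℕ} (x : Fin n → A)
    {N : ℕ} (y : Fin n → Matrix (Fin N) (Fin N) ℂ) (m : ℕ) (δ : ℝ) : Prop :=
  ∀ k, 1 ≤ k → k ≤ m → ∀ w : Fin k → Fin n,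
    ‖ntr (List.ofFn fun l => y (w l)).prod - τ (List.ofFn fun l => x (w l)).prod‖ < δ

theorem FreeAlgebra.mem_span_words {n : ℕ} (p : FreeAlgebra ℂ (Fin n)) :
    p ∈ Submodule.span ℂ
      (Set.range fun l : List (Fin n) => (l.map (FreeAlgebra.ι ℂ)).prod) := by
  have h : p ∈ Algebra.adjoin ℂ (Set.range (FreeAlgebra.ι ℂ : Fin n → FreeAlgebra ℂ (Fin n))) := by
    rw [FreeAlgebra.adjoin_range_ι]; trivial
  rw [← Subalgebra.mem_toSubmodule, Algebra.adjoin_eq_span] at h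
  refine Submodule.span_mono (fun q hq => ?_) h
  refine Submonoid.closure_induction (motive := fun q _ => q ∈ Set.range fun l : List (Fin n) =>
    (l.map (FreeAlgebra.ι ℂ)).prod) ?_ ⟨[], rfl⟩ ?_ hq
  · rintro _ ⟨i, rfl⟩
    exact ⟨[i], by simp⟩
  · rintro _ _ _ _ ⟨l, rfl⟩ ⟨l', rfl⟩
    exact ⟨l ++ l', by simp⟩

theorem map_eq_ofFn_get {α β : Type*} (f : α → β) (l : List α) :
    l.map f = List.ofFn fun j : Fin l.length => f (l.get j) := by
  conv_lhs => rw [← List.ofFn_get l, List.map_ofFn]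
  rfl

/-- If sufficiently many moments of matrices are sufficiently close to those of `x`, then the trace
of a given noncommutative polynomial in them is close to its trace at `x`. -/
theorem eventually_ntr_lift_near {A : Type*} [Ring A] [Algebra ℂ A] {τ : A →ₗ[ℂ] ℂ}
    (hτ : τ 1 = 1) {n : ℕ} (x : Fin n → A) (p : FreeAlgebra ℂ (Fin n)) {ε : ℝ} (hε : 0 < ε) :
    ∀ᶠ q : ℕ × ℝ in atTop ×ˢ 𝓝[>] 0, ∀ N : ℕ, N ≠ 0 →
      ∀ y : Fin n → Matrix (Fin N) (Fin N) ℂ, MomentsNear τ x y q.1 q.2 →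
        ‖ntr (FreeAlgebra.lift ℂ y p) - τ (FreeAlgebra.lift ℂ x p)‖ < ε := by
  have hp := FreeAlgebra.mem_span_words p
  induction hp using Submodule.span_induction generalizing ε with
  | mem p hp =>
    obtain ⟨l, rfl⟩ := hp
    have h1 : ∀ᶠ q : ℕ × ℝ in atTop ×ˢ 𝓝[>] 0, l.length ≤ q.1 :=
      tendsto_fst.eventually (eventually_ge_atTop _)
    have h2 : ∀ᶠ q : ℕ × ℝ in atTop ×ˢ 𝓝[>] 0, q.2 ≤ ε :=
      tendsto_snd.eventually (nhdsWithin_le_nhds (Iic_mem_nhds hε))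
    filter_upwards [h1, h2] with q hq1 hq2 N hN y hy
    simp only [map_list_prod, List.map_map]
    simp only [FreeAlgebra.ι_comp_lift, map_eq_ofFn_get]
    -- `MomentsNear` starts at length one; the empty word is exact since both traces are normalized.
    rcases Nat.eq_zero_or_pos l.length with h0 | h0
    · have : l = [] := List.length_eq_zero_iff.1 h0
      subst this
      simp [ntr_one hN, hτ, hε]
    · exact (hy l.length h0 hq1 l.get).trans_le hq2
  | zero =>
    refine Eventually.of_forall fun q N _ y _ => ?_
    simpa [ntr] using hε
  | add p p' _ _ ih ih' =>
    filter_upwards [ih (half_pos hε), ih' (half_pos hε)] with q h h' N hN y hy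
    rw [map_add, map_add, map_add, ntr_add, add_sub_add_comm]
    refine (norm_add_le _ _).trans_lt ?_
    linarith [h N hN y hy, h' N hN y hy]
  | smul c p _ ih =>
    have hc : 0 < ‖c‖ + 1 := by positivity
    filter_upwards [ih (div_pos hε hc)] with q h N hN y hy
    rw [map_smul, map_smul, map_smul, ntr_smul, smul_eq_mul, ← mul_sub, norm_mul]
    have := (lt_div_iff₀ hc).1 (h N hN y hy)
    nlinarith [norm_nonneg (ntr (FreeAlgebra.lift ℂ y p) - τ (FreeAlgebra.lift ℂ x p))]

end Moments

/-! ### Diagonal matrices and permutations -/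

section Sorting

theorem diag_pow {N : ℕ} (d : Fin N → ℝ) (k : ℕ) : diag d ^ k = diag (d ^ k) := by
  rw [diag, Matrix.diagonal_pow, diag]
  congr 1
  ext j
  simp

open Polynomial in
theorem aeval_diag {N : ℕ} (d : Fin N → ℝ) (p : ℝ[X]) :
    aeval (diag d) (p.map (algebraMap ℝ ℂ)) = diag fun j => p.eval (d j) := by
  rw [aeval_map_algebraMap]
  induction p using Polynomial.induction_on' with
  | add p q hp hq =>
    rw [map_add, hp, hq]
    simp [diag, Matrix.diagonal_add]
  | monomial k a =>
    rw [aeval_monomial, diag_pow, Algebra.algebraMap_eq_smul_one, smul_mul_assoc, one_mul]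
    ext i j
    by_cases h : i = j
    · subst h; simp [diag]
    · simp [diag, h]

open Polynomial in
theorem aeval_unitary_conj {N : ℕ} (V : U N) (A : Matrix (Fin N) (Fin N) ℂ) (q : ℂ[X]) :
    aeval ((V : Matrix (Fin N) (Fin N) ℂ) * A * star (V : Matrix (Fin N) (Fin N) ℂ)) q =
      (V : Matrix (Fin N) (Fin N) ℂ) * aeval A q * star (V : Matrix (Fin N) (Fin N) ℂ) := by
  have := aeval_algHom_apply (Unitary.conjStarAlgAut ℂ (Matrix (Fin N) (Fin N) ℂ) V).toAlgEquiv A q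
  simpa [Unitary.conjStarAlgAut_apply] using this

theorem ntr_conj_pow {N : ℕ} (V : U N) (A : Matrix (Fin N) (Fin N) ℂ) (k : ℕ) :
    ntr (((V : Matrix (Fin N) (Fin N) ℂ) * A * star (V : Matrix (Fin N) (Fin N) ℂ)) ^ k) =
      ntr (A ^ k) := by
  have h := aeval_unitary_conj V A (Polynomial.X ^ k)
  simp only [map_pow, Polynomial.aeval_X] at h
  rw [h, ntr_mul_comm, ← mul_assoc, Unitary.coe_star_mul_self, one_mul]

/-- The unitary matrix of a permutation. -/
noncomputable def permU {N : ℕ} (σ : Equiv.Perm (Fin N)) : U N :=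
  ⟨(Equiv.toPEquiv σ).toMatrix, by
    rw [Matrix.mem_unitaryGroup_iff', Matrix.star_eq_conjTranspose, Matrix.conjTranspose]
    ext i j
    have h : ∀ x, (j = σ x ∧ x = σ.symm i) ↔ (x = σ.symm i ∧ i = j) := by
      intro x
      constructor
      · rintro ⟨rfl, rfl⟩; simp
      · rintro ⟨rfl, rfl⟩; simp
    simp [Matrix.mul_apply, PEquiv.toMatrix_apply, Matrix.one_apply, eq_comm, ← ite_and, h]
    by_cases hij : i = j <;> simp [hij, Finset.filter_eq']⟩

theorem permU_conj_diag {N : ℕ} (σ : Equiv.Perm (Fin N)) (d : Fin N → ℝ) :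
    (permU σ : Matrix (Fin N) (Fin N) ℂ) * diag d * star (permU σ : Matrix (Fin N) (Fin N) ℂ) =
      diag (d ∘ σ) := by
  ext i j
  simp [permU, diag, Matrix.mul_apply, PEquiv.toMatrix_apply, Matrix.diagonal_apply,
    Matrix.star_apply]
  split_ifs with h
  · rw [h]
  · rfl

theorem exists_perm_antitone {N : ℕ} (d : Fin N → ℝ) :
    ∃ σ : Equiv.Perm (Fin N), Antitone (d ∘ σ) := by
  refine ⟨Tuple.sort (fun i => -d i), fun i j hij => ?_⟩
  have := Tuple.monotone_sort (fun i => -d i) hij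
  simpa using this

/-- A conjugate of a diagonal matrix is a conjugate of the sorted diagonal matrix. -/
theorem exists_perm_conj_diag_eq {N : ℕ} (d : Fin N → ℝ) :
    ∃ σ τ : Equiv.Perm (Fin N), Antitone (d ∘ τ) ∧ ∀ V : U N,
      (V : Matrix (Fin N) (Fin N) ℂ) * diag d * star (V : Matrix (Fin N) (Fin N) ℂ) =
        ((V * permU σ : U N) : Matrix (Fin N) (Fin N) ℂ) * diag (d ∘ τ) *
          star ((V * permU σ : U N) : Matrix (Fin N) (Fin N) ℂ) := by
  obtain ⟨τ, hτ⟩ := exists_perm_antitone d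
  refine ⟨τ⁻¹, τ, hτ, fun V => ?_⟩
  have h := permU_conj_diag τ⁻¹ (d ∘ τ)
  have e : (d ∘ τ) ∘ (τ⁻¹ : Equiv.Perm (Fin N)) = d := by ext i; simp
  rw [e] at h
  rw [Submonoid.coe_mul, star_mul, ← h]
  simp only [mul_assoc]

end Sorting

end OrbitalEntropy

namespace OrbitalEntropy

/-! ### Haar measure and the factorial factor -/

section HaarInvariance

instance isMulRightInvariant_haarU (N : ℕ) : (haarU N).IsMulRightInvariant where
  map_mul_right_eq_self g := by
    have : IsProbabilityMeasure (Measure.map (· * g) (haarU N)) :=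
      Measure.isProbabilityMeasure_map (measurable_mul_const g).aemeasurable
    exact Measure.isHaarMeasure_eq_of_isProbabilityMeasure _ _

/-- Right translation is a measurable equivalence, so `s` may be an arbitrary set; measurability of
the microstate sets is never needed. -/
theorem pi_haarU_preimage_mul_right {n N : ℕ} (g : Fin n → U N) (s : Set (Fin n → U N)) :
    Measure.pi (fun _ : Fin n => haarU N) ((fun V i => V i * g i) ⁻¹' s) =
      Measure.pi (fun _ : Fin n => haarU N) s := by
  have h := measurePreserving_pi (fun _ : Fin n => haarU N) (fun _ => haarU N)
    (fun i => measurePreserving_mul_right (haarU N) (g i))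
  exact MeasurePreserving.measure_preimage_equiv
    (f := MeasurableEquiv.piCongrRight fun i => MeasurableEquiv.mulRight (g i)) h s

/-- A set of unitary tuples that is covered by the permutation translates of another one. -/
theorem pi_haarU_le_of_perm {n N : ℕ} {s t : Set (Fin n → U N)}
    (h : ∀ V ∈ s, ∃ σ : Fin n → Equiv.Perm (Fin N), (fun i => V i * permU (σ i)) ∈ t) :
    Measure.pi (fun _ : Fin n => haarU N) s ≤
      ENNReal.ofReal ((N.factorial : ℝ) ^ n) * Measure.pi (fun _ : Fin n => haarU N) t := by
  have hsub : s ⊆ ⋃ σ : Fin n → Equiv.Perm (Fin N),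
      (fun V i => V i * permU (σ i)) ⁻¹' t := fun V hV => Set.mem_iUnion.2 (h V hV)
  refine (measure_mono hsub).trans ((measure_iUnion_fintype_le _ _).trans (le_of_eq ?_))
  simp only [pi_haarU_preimage_mul_right, Finset.sum_const, nsmul_eq_mul, Finset.card_univ,
    Fintype.card_pi, Fintype.card_perm, Fintype.card_fin, Finset.prod_const]
  rw [ENNReal.ofReal_pow (by positivity), ENNReal.ofReal_natCast]
  norm_cast

/-- `N! ≤ N^N` bounds the term by `n * log N / N`. -/
theorem tendsto_log_factorial_pow_div_sq (n : ℕ) :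
    Tendsto (fun N : ℕ => ((N : ℝ) ^ 2)⁻¹ * Real.log ((N.factorial : ℝ) ^ n)) atTop (𝓝 0) := by
  have h1 : Tendsto (fun N : ℕ => (n : ℝ) * (Real.log N / N)) atTop (𝓝 0) := by
    have := (Real.isLittleO_log_id_atTop.tendsto_div_nhds_zero.comp
      tendsto_natCast_atTop_atTop).const_mul (n : ℝ)
    simpa using this
  refine squeeze_zero (fun N => ?_) (fun N => ?_) h1
  · have : (1 : ℝ) ≤ (N.factorial : ℝ) ^ n :=
      one_le_pow₀ (by exact_mod_cast N.factorial_pos)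
    exact mul_nonneg (by positivity) (Real.log_nonneg this)
  · rcases Nat.eq_zero_or_pos N with rfl | hN
    · simp
    have hN' : (0 : ℝ) < N := by exact_mod_cast hN
    have h2 : Real.log N.factorial ≤ N * Real.log N := by
      rw [← Real.log_pow]
      exact Real.log_le_log (by exact_mod_cast N.factorial_pos)
        (by exact_mod_cast N.factorial_le_pow)
    rw [Real.log_pow]
    calc ((N : ℝ) ^ 2)⁻¹ * (n * Real.log N.factorial) ≤ ((N : ℝ) ^ 2)⁻¹ * (n * (N * Real.log N)) := by
          gcongr
      _ = _ := by field_simp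

theorem limsup_log_le_of_le_factorial_pow_mul (n : ℕ) {μ ν : ℕ → ENNReal}
    (h : ∀ N, N ≠ 0 → μ N ≤ ENNReal.ofReal ((N.factorial : ℝ) ^ n) * ν N) :
    limsup (fun N : ℕ => (((N : ℝ) ^ 2)⁻¹ : ℝ) * ENNReal.log (μ N)) atTop ≤
      limsup (fun N : ℕ => (((N : ℝ) ^ 2)⁻¹ : ℝ) * ENNReal.log (ν N)) atTop := by
  let u : ℕ → EReal := fun N => ((((N : ℝ) ^ 2)⁻¹ * Real.log ((N.factorial : ℝ) ^ n) : ℝ) : EReal)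
  let v : ℕ → EReal := fun N => (((N : ℝ) ^ 2)⁻¹ : ℝ) * ENNReal.log (ν N)
  have hu : limsup u atTop = 0 := by
    have : Tendsto u atTop (𝓝 ((0 : ℝ) : EReal)) :=
      (continuous_coe_real_ereal.tendsto 0).comp (tendsto_log_factorial_pow_div_sq n)
    exact this.limsup_eq
  have huv : limsup (fun N : ℕ => (((N : ℝ) ^ 2)⁻¹ : ℝ) * ENNReal.log (μ N)) atTop ≤
      limsup (u + v) atTop := by
    refine limsup_le_limsup ?_
    filter_upwards [eventually_ne_atTop 0] with N hN
    have hpos : 0 < (N.factorial : ℝ) ^ n := by have := N.factorial_pos; positivity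
    have h0 : (0 : ℝ) ≤ ((N : ℝ) ^ 2)⁻¹ := by positivity
    calc (((N : ℝ) ^ 2)⁻¹ : ℝ) * ENNReal.log (μ N) ≤
          (((N : ℝ) ^ 2)⁻¹ : ℝ) * ENNReal.log (ENNReal.ofReal ((N.factorial : ℝ) ^ n) * ν N) :=
          mul_le_mul_of_nonneg_left (ENNReal.log_monotone (h N hN)) (EReal.coe_nonneg.2 h0)
      _ = u N + v N := by
          rw [ENNReal.log_mul_add, ENNReal.log_ofReal_of_pos hpos,
            EReal.left_distrib_of_nonneg_of_ne_top (EReal.coe_nonneg.2 h0) (EReal.coe_ne_top _)]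
          rfl
  calc _ ≤ limsup (u + v) atTop := huv
    _ ≤ limsup u atTop + limsup v atTop :=
        EReal.limsup_add_le (Or.inl (by rw [hu]; simp)) (Or.inl (by rw [hu]; simp))
    _ = limsup v atTop := by rw [hu, zero_add]

end HaarInvariance

/-! ### Comparison of orbital microstates -/

section Comparison

theorem orbMicrostates_mono_cutoff {A : Type*} [Ring A] [Algebra ℂ A] (τ : A →ₗ[ℂ] ℂ) {R R' : ℝ}
    (hR : R ≤ R') {n : ℕ} (x : Fin n → A) (N m : ℕ) (δ : ℝ) :
    orbMicrostates τ R x N m δ ⊆ orbMicrostates τ R' x N m δ := by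
  rintro V ⟨d, hd, hw⟩
  exact ⟨d, fun i => ⟨(hd i).1, fun j => ((hd i).2.1 j).trans hR, (hd i).2.2⟩, hw⟩

theorem chiOrbCutoff_mono {A : Type*} [Ring A] [Algebra ℂ A] (τ : A →ₗ[ℂ] ℂ) {R R' : ℝ}
    (hR : R ≤ R') {n : ℕ} (x : Fin n → A) : chiOrbCutoff τ R x ≤ chiOrbCutoff τ R' x :=
  iInf_mono fun m => iInf₂_mono fun δ _ => limsup_le_limsup <| Eventually.of_forall fun N =>
    mul_le_mul_of_nonneg_left
      (ENNReal.log_monotone (measure_mono (orbMicrostates_mono_cutoff τ hR x N m δ)))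
      (EReal.coe_nonneg.2 (by positivity))

open Polynomial in
theorem FreeAlgebra.lift_prod_map_aeval {B ι : Type*} [Ring B] [Algebra ℂ B] (y : ι → B)
    (q : ι → ℂ[X]) (l : List ι) :
    FreeAlgebra.lift ℂ y (l.map fun i => aeval (FreeAlgebra.ι ℂ i) (q i)).prod =
      (l.map fun i => aeval (y i) (q i)).prod := by
  simp only [map_list_prod, List.map_map]
  congr 2
  ext i
  simp [← aeval_algHom_apply]

variable {H : Type*} [NormedAddCommGroup H] [InnerProductSpace ℂ H] [CompleteSpace H]

open Polynomial in
/-- Orbital microstates of `X` become orbital microstates of `X'` after multiplication by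
permutations, if each `X' i` lies in `W*(X i)`. -/
theorem exists_perm_mul_mem_orbMicrostates {M : VonNeumannAlgebra H}
    {τ : M.toStarSubalgebra →ₗ[ℂ] ℂ} (hτ : IsNormalTracialState τ) {n : ℕ}
    {X X' : Fin n → M.toStarSubalgebra} (hX : ∀ i, IsSelfAdjoint (X i))
    (hX' : ∀ i, IsSelfAdjoint (X' i))
    (hgen : ∀ i, (X' i : H →L[ℂ] H) ∈ vonNeumannGenerated (X i : H →L[ℂ] H)) {R R' : ℝ}
    (hR : ∀ i, ‖X i‖ ≤ R) (hR' : ∀ i, ‖X' i‖ < R') (m' : ℕ) {δ' : ℝ} (hδ' : 0 < δ') :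
    ∃ (m : ℕ) (δ : ℝ), 0 < δ ∧ ∀ N : ℕ, N ≠ 0 → ∀ V ∈ orbMicrostates τ R X N m δ,
      ∃ σ : Fin n → Equiv.Perm (Fin N),
        (fun i => V i * permU (σ i)) ∈ orbMicrostates τ R' X' N m' δ' := by
  set C : ℝ := 1 + |R'| with hC
  have hC1 : 1 ≤ C := le_add_of_nonneg_right (abs_nonneg _)
  have hRC : R' ≤ C := (le_abs_self R').trans (by linarith)
  -- `K` dominates the constant in `norm_trace_word_sub_le` for words of length at most `m'`, so
  -- this approximation costs `δ' / 2`; the `1` keeps `K` positive.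
  set K : ℝ := m' * C ^ m' * ‖(1 : M.toStarSubalgebra)‖ + 1 with hK
  have hK0 : 0 < K := by positivity
  set ε : ℝ := δ' / 2 / K with hε
  have hε0 : 0 < ε := by positivity
  choose p hp hpC hpτ using fun i =>
    hτ.normal.exists_polynomial_near (hX i) (hX' i) (hgen i) (hR i) (hR' i) hε0
  let q : Fin n → ℂ[X] := fun i => (p i).map (algebraMap ℝ ℂ)
  let P : List (Fin n) → FreeAlgebra ℂ (Fin n) := fun l =>
    (l.map fun i => aeval (FreeAlgebra.ι ℂ i) (q i)).prod
  -- There are finitely many words of length at most `m'`, so one pair `(m, δ)` serves them all,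
  -- uniformly in `N`.
  have hev : ∀ᶠ r : ℕ × ℝ in atTop ×ˢ 𝓝[>] 0, ∀ (k : Fin (m' + 1)) (w : Fin k → Fin n), ∀ N : ℕ,
      N ≠ 0 → ∀ y : Fin n → Matrix (Fin N) (Fin N) ℂ, MomentsNear τ X y r.1 r.2 →
        ‖ntr (FreeAlgebra.lift ℂ y (P (List.ofFn w))) -
          τ (FreeAlgebra.lift ℂ X (P (List.ofFn w)))‖ < δ' / 2 :=
    eventually_all.2 fun k => eventually_all.2 fun w =>
      eventually_ntr_lift_near hτ.map_one X _ (half_pos hδ')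
  have hpos : ∀ᶠ r : ℕ × ℝ in atTop ×ˢ 𝓝[>] 0, 0 < r.2 :=
    tendsto_snd.eventually self_mem_nhdsWithin
  obtain ⟨⟨m, δ⟩, hnear, hδ⟩ := (hev.and hpos).exists
  refine ⟨m, δ, hδ, ?_⟩
  rintro N hN V ⟨d, hd, hw⟩
  choose σ ρ hρ hconj using fun i => exists_perm_conj_diag_eq fun j => (p i).eval (d i j)
  let y : Fin n → Matrix (Fin N) (Fin N) ℂ := fun i =>
    (V i : Matrix (Fin N) (Fin N) ℂ) * diag (d i) * star (V i : Matrix (Fin N) (Fin N) ℂ)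
  let W : Fin n → U N := fun i => V i * permU (σ i)
  let d' : Fin n → Fin N → ℝ := fun i => (fun j => (p i).eval (d i j)) ∘ ρ i
  have hy : ∀ i, aeval (y i) (q i) =
      (W i : Matrix (Fin N) (Fin N) ℂ) * diag (d' i) * star (W i : Matrix (Fin N) (Fin N) ℂ) := by
    intro i
    rw [← hconj i (V i), ← aeval_diag]
    exact aeval_unitary_conj _ _ _
  have hwords : ∀ k, k ≤ m' → ∀ w : Fin k → Fin n,
      ‖ntr (List.ofFn fun l => (W (w l) : Matrix (Fin N) (Fin N) ℂ) * diag (d' (w l)) *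
            star (W (w l) : Matrix (Fin N) (Fin N) ℂ)).prod
          - τ (List.ofFn fun l => X' (w l)).prod‖ < δ' := by
    intro k hk w
    have h1 := hnear ⟨k, Nat.lt_succ_of_le hk⟩ w N hN y hw
    rw [FreeAlgebra.lift_prod_map_aeval, FreeAlgebra.lift_prod_map_aeval, List.map_ofFn] at h1
    have h2 := norm_trace_word_sub_le hτ.map_mul_comm hC1 (fun i => (hpC i).trans hRC)
      (fun i => (hR' i).le.trans hRC) (fun i y => hpτ i y) (List.ofFn w) 1
    rw [one_mul, one_mul, List.length_ofFn, abs_of_pos hε0, List.map_ofFn (f := w) (g := X')] at h2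
    have h3 : k * C ^ k * (‖(1 : M.toStarSubalgebra)‖ * ε) ≤ δ' / 2 := by
      calc k * C ^ k * (‖(1 : M.toStarSubalgebra)‖ * ε)
          ≤ m' * C ^ m' * (‖(1 : M.toStarSubalgebra)‖ * ε) := by gcongr
        _ ≤ K * ε := by rw [hK]; linarith
        _ = δ' / 2 := by rw [hε]; field_simp
    have h4 : ((fun i => aeval (y i) (q i)) ∘ w) = fun l =>
        (W (w l) : Matrix (Fin N) (Fin N) ℂ) * diag (d' (w l)) *
          star (W (w l) : Matrix (Fin N) (Fin N) ℂ) := funext fun l => hy (w l)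
    rw [h4] at h1
    have h5 := norm_sub_le_norm_sub_add_norm_sub (ntr (List.ofFn fun l =>
      (W (w l) : Matrix (Fin N) (Fin N) ℂ) * diag (d' (w l)) *
        star (W (w l) : Matrix (Fin N) (Fin N) ℂ)).prod)
      (τ ((List.ofFn w).map fun i => aeval (X i) (q i)).prod)
      (τ (List.ofFn fun l => X' (w l)).prod)
    exact h5.trans_lt ((add_lt_add_of_lt_of_le h1 (h2.trans h3)).trans_eq (add_halves _))
  refine ⟨σ, d', fun i => ⟨hρ i, fun j => hp i _ ((hd i).2.1 _), fun k _ hk => ?_⟩,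
    fun k _ hk w => hwords k hk w⟩
  -- The moments of a single `d' i` come from the constant word, since conjugation by a unitary
  -- drops out of the trace.
  have := hwords k hk fun _ => i
  rwa [List.ofFn_const, List.ofFn_const, List.prod_replicate, List.prod_replicate,
    ntr_conj_pow] at this

theorem chiOrb_le_of_mem_vonNeumannGenerated {M : VonNeumannAlgebra H}
    {τ : M.toStarSubalgebra →ₗ[ℂ] ℂ} (hτ : IsNormalTracialState τ) {n : ℕ}
    {X X' : Fin n → M.toStarSubalgebra} (hX : ∀ i, IsSelfAdjoint (X i))
    (hX' : ∀ i, IsSelfAdjoint (X' i))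
    (hgen : ∀ i, (X' i : H →L[ℂ] H) ∈ vonNeumannGenerated (X i : H →L[ℂ] H)) :
    chiOrb τ X ≤ chiOrb τ X' := by
  refine iSup₂_le fun R _ => ?_
  have hle : ∀ (Y : Fin n → M.toStarSubalgebra) i, ‖Y i‖ ≤ ∑ j, ‖Y j‖ := fun Y i =>
    Finset.single_le_sum (f := fun j => ‖Y j‖) (fun _ _ => norm_nonneg _) (Finset.mem_univ i)
  -- The interval `[-R₁, R₁]` must contain both the entries of the microstates and the spectra of
  -- the `X i`, and `R'` must exceed every `‖X' i‖` strictly.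
  set R₁ : ℝ := max R (∑ j, ‖X j‖)
  set R' : ℝ := ∑ j, ‖X' j‖ + 1
  have hR'0 : 0 < R' := by positivity
  refine (chiOrbCutoff_mono τ (le_max_left R (∑ j, ‖X j‖)) X).trans
    (le_trans ?_ (le_iSup₂_of_le R' hR'0 le_rfl))
  refine le_iInf fun m' => le_iInf₂ fun δ' hδ' => ?_
  obtain ⟨m, δ, hδ, h⟩ := exists_perm_mul_mem_orbMicrostates hτ hX hX' hgen (R := R₁) (R' := R')
    (fun i => (hle X i).trans (le_max_right _ _)) (fun i => (hle X' i).trans_lt (lt_add_one _))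
    m' hδ'
  refine (iInf_le_of_le m (iInf₂_le δ hδ)).trans ?_
  exact limsup_log_le_of_le_factorial_pow_mul n fun N hN => pi_haarU_le_of_perm (h N hN)

end Comparison

end OrbitalEntropy

theorem proposition2p8 {H : Type*} [NormedAddCommGroup H] [InnerProductSpace ℂ H]
    [CompleteSpace H] (M : VonNeumannAlgebra H) (τ : M.toStarSubalgebra →ₗ[ℂ] ℂ)
    (hτ : OrbitalEntropy.IsNormalTracialState τ) {n : ℕ}
    (X X' : Fin n → M.toStarSubalgebra)
    (hX : ∀ i, IsSelfAdjoint (X i)) (hX' : ∀ i, IsSelfAdjoint (X' i))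
    (hgen : ∀ i, OrbitalEntropy.vonNeumannGenerated (X i : H →L[ℂ] H) =
      OrbitalEntropy.vonNeumannGenerated (X' i : H →L[ℂ] H)) :
    OrbitalEntropy.chiOrb τ X = OrbitalEntropy.chiOrb τ X' := by
  refine le_antisymm
    (OrbitalEntropy.chiOrb_le_of_mem_vonNeumannGenerated hτ hX hX' fun i => ?_)
    (OrbitalEntropy.chiOrb_le_of_mem_vonNeumannGenerated hτ hX' hX fun i => ?_)
  · rw [hgen i]
    exact (OrbitalEntropy.isLeast_vonNeumannGenerated _).1
  · rw [← hgen i]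
    exact (OrbitalEntropy.isLeast_vonNeumannGenerated _).1
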